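/- \textbf{Conventions.} Let $\mathcal C_2^m=\{x\in\mathbf R^{m+1}\,;\,x_1^2+\dots+x_m^2=x_{m+1}^2\}$ ($m\ge 2$) be the standard double cone. A map from an open subset $U$ of $\mathcal C_2^m$ is called real analytic if it is the restriction of a real analytic map defined on an open set $\Omega\subset\mathbf R^{m+1}$ with $\Omega\cap\mathcal C_2^m=U$. An $m$-dimensional real analytic \emph{DC-manifold} is a locally compact, second countable Hausdorff space with an atlas of homeomorphisms from open sets onto connected open subsets of $\mathcal C_2^m$ whose transition maps are real analytic; a \emph{DC-coordinate system} is a homeomorphism from an open set onto an open subset of $\mathcal C_2^m$ that is compatible with this atlas, and a \emph{DC-point} is a point mapped to the origin by a DC-coordinate system around it. Let $N^n$ be a real analytic manifold and $n>m$. A map $f:X^m\to N^n$ is a \emph{real analytic DC-immersion} if it is real analytic in the charts and every $p\in X^m$ has a DC-coordinate system $(U,\phi)$ around it and a real analytic diffeomorphism $\Phi$ from a neighborhood of $f(p)$ containing $f(U)$ onto an open subset of $\mathbf R^n$ with $\Phi\circ f\circ\phi^{-1}(a)=(a,0,\dots,0)$ for all $a\in\phi(U)$. Let $S^3_1=\{x\in\mathbf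 R^4\,;\,-x_0^2+x_1^2+x_2^2+x_3^2=1\}$ be the de Sitter $3$-space in the Lorentz--Minkowski space of signature $(-,+,+,+)$. A real analytic DC-immersion $f:X^2\to S^3_1$ of a connected $2$-dimensional real analytic DC-manifold is a \emph{space-like CMC-1 DC-immersion} if, off the DC-points of $X^2$, it is a space-like immersion of constant mean curvature one (with respect to a suitable local choice of the unit normal vector field). A non-empty subset $S\subset N^n$ is \emph{analytically complete} if every real analytic map $\Gamma:[0,1]\to N^n$ with $\Gamma([0,\varepsilon))\subset S$ for some $\varepsilon\in(0,1)$ satisfies $\Gamma([0,1])\subset S$. \textbf{Proposition (type TP).} Put $$x_0(s)=\sinh s-\tfrac s2\cosh s,\qquad x_3(s)=\cosh s-\tfrac s2\sinh s,$$ and let $f_{\mathrm{TP}}:\mathbf R\times(\mathbf R/2\pi\mathbf Z)\to S^3_1$, $$f_{\mathrm{TP}}(s,\theta)=\bigl(x_0(s),\tfrac s2\cos\theta,\tfrac s2\sin\theta,x_3(s)\bigr)$$ be the G-catenoid of type TP. Let $X_{\mathrm{TP}}=\{(\xi,\eta,s)\in\mathbf R^3\,;\,\xi^2+\eta^2=s^2/4\}$,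 with the DC-structure given by the global chart $(\xi,\eta,s)\mapsto(\xi,\eta,s/2)\in\mathcal C_2^2$, and let $$\tilde f_{\mathrm{TP}}:X_{\mathrm{TP}}\to S^3_1,\qquad \tilde f_{\mathrm{TP}}(\xi,\eta,s)=(x_0(s),\xi,\eta,x_3(s)).$$ Then: \begin{enumerate} \item $X_{\mathrm{TP}}$ is a $2$-dimensional real analytic DC-manifold whose only DC-point is $(0,0,0)$; \item $f_{\mathrm{TP}}(s,\theta)=\tilde f_{\mathrm{TP}}(\tfrac s2\cos\theta,\tfrac s2\sin\theta,s)$ for all $(s,\theta)$, and $f_{\mathrm{TP}}$ and $\tilde f_{\mathrm{TP}}$ have the same image; \item $\tilde f_{\mathrm{TP}}$ is a proper map and a real analytic space-like CMC-1 DC-immersion (it is in this sense that $f_{\mathrm{TP}}$ is one); \item the image of $f_{\mathrm{TP}}$ is analytically complete in $S^3_1$. \end{enumerate} -/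

import Mathlib

open Set

noncomputable section

/-! ### Analytic completeness -/

/-- A non-empty subset `S` of a (real analytic, embedded) submanifold `N` of `ℝᵏ` is analytically
complete in `N` if every real analytic curve `Γ : [0,1] → N` whose initial part lies in `S` lies
in `S` entirely.  A curve in `N` is real analytic iff it is so as a curve in `ℝᵏ`. -/
def AnalyticallyComplete {k : ℕ} {N : Set (Fin k → ℝ)} (S : Set N) : Prop :=
  S.Nonempty ∧
    ∀ Γ : ℝ → N, AnalyticOn ℝ (fun t => (Γ t : Fin k → ℝ)) (Icc 0 1) →
      (∃ ε ∈ Ioo (0 : ℝ) 1, ∀ t ∈ Ico (0 : ℝ) ε, Γ t ∈ S) →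
      ∀ t ∈ Icc (0 : ℝ) 1, Γ t ∈ S

/-! ### Real analytic double-cone manifolds -/

/-- The `m`-dimensional standard double cone `x₁² + ⋯ + xₘ² = xₘ₊₁²` in `ℝᵐ⁺¹`. -/
def doubleCone (m : ℕ) : Set (Fin (m + 1) → ℝ) :=
  {x | ∑ j : Fin m, x j.castSucc ^ 2 = x (Fin.last m) ^ 2}

/-- The standard double cone, as a topological space. -/
abbrev DoubleCone (m : ℕ) : Type := doubleCone m

/-- A map `μ : U → ℝᵏ` on a subset `U` of the double cone is real analytic if it is the restriction
of a real analytic map on an open set `Ω` of `ℝᵐ⁺¹` with `Ω ∩ doubleCone = U`.  (In particular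
`U` is open in the double cone.) -/
def IsConeAnalytic {m k : ℕ} (U : Set (DoubleCone m)) (μ : DoubleCone m → Fin k → ℝ) : Prop :=
  ∃ (Ω : Set (Fin (m + 1) → ℝ)) (g : (Fin (m + 1) → ℝ) → Fin k → ℝ),
    IsOpen Ω ∧ AnalyticOnNhd ℝ g Ω ∧ (∀ x : DoubleCone m, (x : Fin (m + 1) → ℝ) ∈ Ω ↔ x ∈ U) ∧
      ∀ x ∈ U, g x = μ x

/-- The coordinate change `ψ ∘ φ⁻¹ : φ(U ∩ V) → ψ(U ∩ V)` is real analytic. -/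
def AnalyticTransition {m : ℕ} {X : Type*} [TopologicalSpace X]
    (φ ψ : OpenPartialHomeomorph X (DoubleCone m)) : Prop :=
  IsConeAnalytic (φ.symm.trans ψ).source (fun a => (ψ (φ.symm a) : Fin (m + 1) → ℝ))

/-- The atlas of `X` modelled on the double cone makes `X` an `m`-dimensional real analytic
double-cone manifold.  (That the charts are homeomorphisms between open sets and cover `X` is part
of `ChartedSpace`.) -/
structure IsDCManifold (m : ℕ) (X : Type*) [TopologicalSpace X]
    [ChartedSpace (DoubleCone m) X] : Prop where
  two_le : 2 ≤ m
  locallyCompact : LocallyCompactSpace X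
  hausdorff : T2Space X
  secondCountable : SecondCountableTopology X
  connected_target : ∀ φ ∈ atlas (DoubleCone m) X, IsConnected φ.target
  compatible : ∀ φ ∈ atlas (DoubleCone m) X, ∀ ψ ∈ atlas (DoubleCone m) X,
    AnalyticTransition φ ψ

/-- `ψ` is a local DC-coordinate system of `X`. -/
def IsDCCoordinate {m : ℕ} {X : Type*} [TopologicalSpace X] [ChartedSpace (DoubleCone m) X]
    (ψ : OpenPartialHomeomorph X (DoubleCone m)) : Prop :=
  ∀ φ ∈ atlas (DoubleCone m) X, AnalyticTransition φ ψ ∧ AnalyticTransition ψ φ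

/-- `p` is a DC-point: some local DC-coordinate system maps it to the apex of the double cone. -/
def IsDCPoint (m : ℕ) {X : Type*} [TopologicalSpace X] [ChartedSpace (DoubleCone m) X]
    (p : X) : Prop :=
  ∃ ψ : OpenPartialHomeomorph X (DoubleCone m),
    IsDCCoordinate ψ ∧ p ∈ ψ.source ∧ (ψ p : Fin (m + 1) → ℝ) = 0

/-! ### Real analytic DC-immersions into an embedded real analytic submanifold of `ℝᵏ` -/

/-- `f : X → N ⊆ ℝᵏ` is DC-analytic: it is real analytic in every chart of the DC-structure. -/
def IsDCAnalytic (m : ℕ) {X : Type*} [TopologicalSpace X] [ChartedSpace (DoubleCone m) X]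
    {k : ℕ} {N : Set (Fin k → ℝ)} (f : X → N) : Prop :=
  ∀ φ ∈ atlas (DoubleCone m) X,
    IsConeAnalytic φ.target (fun a => (f (φ.symm a) : Fin k → ℝ))

/-- `Φ` restricts to a real analytic diffeomorphism from the open subset `N ∩ Ω` of the
embedded submanifold `N ⊆ ℝᵏ` onto an open subset of `ℝⁿ`. -/
def IsAnalyticDiffeo {k n : ℕ} (N Ω : Set (Fin k → ℝ))
    (Φ : (Fin k → ℝ) → Fin n → ℝ) : Prop :=
  IsOpen Ω ∧ AnalyticOnNhd ℝ Φ Ω ∧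
    ∃ (Ω₀ : Set (Fin n → ℝ)) (Ψ : (Fin n → ℝ) → Fin k → ℝ),
      IsOpen Ω₀ ∧ AnalyticOnNhd ℝ Ψ Ω₀ ∧ MapsTo Φ (N ∩ Ω) Ω₀ ∧ MapsTo Ψ Ω₀ (N ∩ Ω) ∧
        InvOn Ψ Φ (N ∩ Ω) Ω₀

/-- `p` is a DC-regular point of `f : Xᵐ → Nⁿ`: in a suitable DC-coordinate system around `p` and
suitable real analytic coordinates of `N` around `f p`, the map `f` is `a ↦ (a, 0)`. -/
def IsDCRegularPoint (m n : ℕ) {X : Type*} [TopologicalSpace X] [ChartedSpace (DoubleCone m) X]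
    {k : ℕ} {N : Set (Fin k → ℝ)} (f : X → N) (p : X) : Prop :=
  ∃ φ : OpenPartialHomeomorph X (DoubleCone m), IsDCCoordinate φ ∧ p ∈ φ.source ∧
    ∃ (Ω : Set (Fin k → ℝ)) (Φ : (Fin k → ℝ) → Fin n → ℝ),
      IsAnalyticDiffeo N Ω Φ ∧ (∀ q ∈ φ.source, (f q : Fin k → ℝ) ∈ Ω) ∧
        ∀ a ∈ φ.target, ∀ i : Fin n,
          Φ (f (φ.symm a)) i =
            if h : (i : ℕ) < m + 1 then (a : Fin (m + 1) → ℝ) ⟨i, h⟩ else 0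

/-- A real analytic DC-immersion `f : Xᵐ → Nⁿ`, `n > m`. -/
def IsDCImmersion (m n : ℕ) {X : Type*} [TopologicalSpace X] [ChartedSpace (DoubleCone m) X]
    {k : ℕ} {N : Set (Fin k → ℝ)} (f : X → N) : Prop :=
  m < n ∧ IsDCAnalytic m f ∧ ∀ p : X, IsDCRegularPoint m n f p

/-! ### de Sitter 3-space and space-like surfaces of constant mean curvature one -/

/-- The Lorentzian inner product of `ℝ⁴₁`, of signature `(-,+,+,+)`. -/
def lorentz (x y : Fin 4 → ℝ) : ℝ :=
  -(x 0 * y 0) + x 1 * y 1 + x 2 * y 2 + x 3 * y 3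

/-- The de Sitter 3-space `S³₁ ⊆ ℝ⁴₁`. -/
def deSitter : Set (Fin 4 → ℝ) := {x | lorentz x x = 1}

/-- The `i`-th partial derivative of `F : ℝ² → ℝ⁴`. -/
def partialD (i : Fin 2) (F : (Fin 2 → ℝ) → Fin 4 → ℝ) (u : Fin 2 → ℝ) : Fin 4 → ℝ :=
  fderiv ℝ F u (Pi.single i 1)

/-- The coefficient `gᵢⱼ` of the first fundamental form of `F`. -/
def firstForm (F : (Fin 2 → ℝ) → Fin 4 → ℝ) (i j : Fin 2) (u : Fin 2 → ℝ) : ℝ :=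
  lorentz (partialD i F u) (partialD j F u)

/-- The coefficient `hᵢⱼ` of the second fundamental form of `F` with respect to a vector `ν` normal
to `F` and tangent to `S³₁`. -/
def secondForm (F : (Fin 2 → ℝ) → Fin 4 → ℝ) (ν : Fin 4 → ℝ) (i j : Fin 2)
    (u : Fin 2 → ℝ) : ℝ :=
  lorentz (partialD i (partialD j F) u) ν

/-- The mean curvature of `F`, half the trace of the second fundamental form with respect to the
first one. -/
def meanCurvature (F : (Fin 2 → ℝ) → Fin 4 → ℝ) (ν : Fin 4 → ℝ) (u : Fin 2 → ℝ) : ℝ :=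
  (firstForm F 0 0 u * secondForm F ν 1 1 u - 2 * firstForm F 0 1 u * secondForm F ν 0 1 u +
      firstForm F 1 1 u * secondForm F ν 0 0 u) /
    (2 * (firstForm F 0 0 u * firstForm F 1 1 u - firstForm F 0 1 u ^ 2))

/-- `F` is, at `u`, a space-like immersion into `S³₁` (its first fundamental form is positive
definite) whose mean curvature is `1` with respect to one of its two unit normal vectors `ν`
(replacing `ν` by `-ν` changes the sign of the mean curvature). -/
def IsSpacelikeCMCOneAt (F : (Fin 2 → ℝ) → Fin 4 → ℝ) (u : Fin 2 → ℝ) : Prop :=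
  F u ∈ deSitter ∧ 0 < firstForm F 0 0 u ∧
    0 < firstForm F 0 0 u * firstForm F 1 1 u - firstForm F 0 1 u ^ 2 ∧
    ∃ ν : Fin 4 → ℝ, lorentz ν ν = -1 ∧ lorentz ν (F u) = 0 ∧
      (∀ i : Fin 2, lorentz ν (partialD i F u) = 0) ∧ meanCurvature F ν u = 1

/-- `f : X² → S³₁` is a real analytic space-like CMC-1 DC-immersion: `X` is a connected
2-dimensional real analytic DC-manifold, `f` is a real analytic DC-immersion, and around each
point `p` which is not a DC-point there are local coordinates `u ∈ V ⊆ ℝ²`, given by a regular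
real analytic parametrization `c` of the part of the double cone off its apex, in which `f` is a
space-like immersion of constant mean curvature one. -/
def IsSpacelikeCMCOneDCImmersion {X : Type*} [TopologicalSpace X]
    [ChartedSpace (DoubleCone 2) X] (f : X → deSitter) : Prop :=
  IsDCManifold 2 X ∧ ConnectedSpace X ∧ IsDCImmersion 2 3 f ∧
    ∀ p : X, ¬ IsDCPoint 2 p →
      ∃ ψ : OpenPartialHomeomorph X (DoubleCone 2), IsDCCoordinate ψ ∧ p ∈ ψ.source ∧
        ∃ (V : Set (Fin 2 → ℝ)) (c : (Fin 2 → ℝ) → DoubleCone 2),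
          IsOpen V ∧ AnalyticOnNhd ℝ (fun u => (c u : Fin 3 → ℝ)) V ∧
          (∀ u ∈ V, Function.Injective (fderiv ℝ (fun w => (c w : Fin 3 → ℝ)) u)) ∧
          InjOn c V ∧ (∀ u ∈ V, c u ∈ ψ.target ∧ (c u : Fin 3 → ℝ) ≠ 0) ∧
          ψ p ∈ c '' V ∧
          ∀ u ∈ V, IsSpacelikeCMCOneAt (fun w => (f (ψ.symm (c w)) : Fin 4 → ℝ)) u

/-! ### The G-catenoid of type TP -/

/-- The component `x₀(s) = sinh s - (s/2) cosh s` of the profile curve. -/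
def x0TP (s : ℝ) : ℝ := Real.sinh s - s / 2 * Real.cosh s

/-- The component `x₃(s) = cosh s - (s/2) sinh s` of the profile curve. -/
def x3TP (s : ℝ) : ℝ := Real.cosh s - s / 2 * Real.sinh s

/-- The profile curve, lying in `S³₁ ∩ {x₂ = 0}`. -/
def profileTP (s : ℝ) : Fin 4 → ℝ := ![x0TP s, s / 2, 0, x3TP s]

/-- The rotation of `ℝ⁴₁` of angle `θ ∈ T¹ = ℝ / 2πℤ` in the `(x₁, x₂)`-plane. -/
def rotationTP (θ : Real.Angle) : Matrix (Fin 4) (Fin 4) ℝ :=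
  !![1, 0, 0, 0;
     0, θ.cos, -θ.sin, 0;
     0, θ.sin, θ.cos, 0;
     0, 0, 0, 1]

theorem rotation_profile_apply (s : ℝ) (θ : Real.Angle) :
    (rotationTP θ).mulVec (profileTP s) =
      ![x0TP s, s / 2 * θ.cos, s / 2 * θ.sin, x3TP s] := by
  ext i
  fin_cases i <;>
    simp [rotationTP, profileTP, Matrix.mulVec, dotProduct, Fin.sum_univ_four, mul_comm]

theorem mem_deSitter_TP {ξ η s : ℝ} (h : ξ ^ 2 + η ^ 2 = s ^ 2 / 4) :
    ![x0TP s, ξ, η, x3TP s] ∈ deSitter := by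
  have hc := Real.cosh_sq s
  simp only [deSitter, lorentz, x0TP, x3TP, Set.mem_ofPred_eq, Matrix.cons_val]
  linear_combination h + (1 - s ^ 2 / 4) * hc

/-- The G-catenoid `f_TP : ℝ × T¹ → S³₁` of type TP. -/
def fTP (q : ℝ × Real.Angle) : deSitter :=
  ⟨(rotationTP q.2).mulVec (profileTP q.1), by
    rw [rotation_profile_apply]
    apply mem_deSitter_TP
    linear_combination q.1 ^ 2 / 4 * Real.Angle.cos_sq_add_sin_sq q.2⟩

/-- The surface `X_TP = {(ξ, η, s) ; ξ² + η² = s² / 4}`. -/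
def surfaceTP : Set (Fin 3 → ℝ) := {p | p 0 ^ 2 + p 1 ^ 2 = p 2 ^ 2 / 4}

/-- The linear homeomorphism `(ξ, η, s) ↦ (ξ, η, s / 2)` from `X_TP` onto the standard double
cone. -/
def coneChartTP : surfaceTP ≃ₜ DoubleCone 2 where
  toFun p := ⟨![p.1 0, p.1 1, p.1 2 / 2], by
    have h : p.1 0 ^ 2 + p.1 1 ^ 2 = p.1 2 ^ 2 / 4 := p.2
    simp only [doubleCone, Set.mem_ofPred_eq, Fin.sum_univ_two]
    change p.1 0 ^ 2 + p.1 1 ^ 2 = (p.1 2 / 2) ^ 2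
    rw [h]; ring⟩
  invFun a := ⟨![a.1 0, a.1 1, 2 * a.1 2], by
    have h := a.2
    simp only [doubleCone, Set.mem_ofPred_eq, Fin.sum_univ_two] at h
    change a.1 0 ^ 2 + a.1 1 ^ 2 = (2 * a.1 2) ^ 2 / 4
    have h' : a.1 0 ^ 2 + a.1 1 ^ 2 = a.1 2 ^ 2 := h
    rw [h']; ring⟩
  left_inv p := by
    apply Subtype.ext
    ext i
    fin_cases i
    · rfl
    · rfl
    · change 2 * (p.1 2 / 2) = p.1 2
      ring
  right_inv a := by
    apply Subtype.ext
    ext i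
    fin_cases i
    · rfl
    · rfl
    · change 2 * a.1 2 / 2 = a.1 2
      ring
  continuous_toFun := by
    apply Continuous.subtype_mk
    have h : ∀ i, Continuous fun p : surfaceTP => p.1 i := fun i =>
      (continuous_apply i).comp continuous_subtype_val
    refine continuous_pi fun i => ?_
    fin_cases i
    · exact h 0
    · exact h 1
    · exact (h 2).div_const 2
  continuous_invFun := by
    apply Continuous.subtype_mk
    have h : ∀ i, Continuous fun a : DoubleCone 2 => a.1 i := fun i =>
      (continuous_apply i).comp continuous_subtype_val
    refine continuous_pi fun i => ?_
    fin_cases i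
    · exact h 0
    · exact h 1
    · exact continuous_const.mul (h 2)

/-- The DC-structure of `X_TP`, given by the single global chart `(ξ, η, s) ↦ (ξ, η, s / 2)`. -/
instance chartedSpaceTP : ChartedSpace (DoubleCone 2) surfaceTP :=
  coneChartTP.toOpenPartialHomeomorph.singletonChartedSpace rfl

/-- The map `(ξ, η, s) ↦ (x₀(s), ξ, η, x₃(s))` from `X_TP` to `S³₁`. -/
def fTildeTP (p : surfaceTP) : deSitter :=
  ⟨![x0TP (p.1 2), p.1 0, p.1 1, x3TP (p.1 2)], mem_deSitter_TP p.2⟩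

/-- The map `(s, θ) ↦ (x₁(s, θ), x₂(s, θ), s) = ((s/2) cos θ, (s/2) sin θ, s)` from `ℝ × T¹` to
`X_TP`. -/
def toSurfaceTP (q : ℝ × Real.Angle) : surfaceTP :=
  ⟨![q.1 / 2 * q.2.cos, q.1 / 2 * q.2.sin, q.1], by
    change (q.1 / 2 * q.2.cos) ^ 2 + (q.1 / 2 * q.2.sin) ^ 2 = q.1 ^ 2 / 4
    linear_combination q.1 ^ 2 / 4 * Real.Angle.cos_sq_add_sin_sq q.2⟩

end

noncomputable section

/-! ### Analytic maps on the double cone -/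

/-! Since `X_TP` has one global chart, which is linear, its DC-structure costs little; the four
points with content are these.

The apex is intrinsic. A coordinate change `g` defined at the apex, with analytic inverse, has
invertible derivative `L` there, because the cone spans `ℝ³`. The quadric `Q` of the cone vanishes
along `t ↦ g (t • v)` for every cone vector `v`, so `dQ ∘ L = 0` at `g 0`. Hence `dQ = 0` at `g 0`,
and the only critical point of `Q` is the origin.

Regularity at every point, apex included, amounts to choosing coordinates on `S³₁`. Where `x₃ ≠ 0`
the space is a graph over `(x₀, x₁, x₂)`, and where also `x₀'(s) ≠ 0` the parameter `s` can replace
`x₀`; then the map reads `(ξ, η, s) ↦ (ξ, η, s / 2)`. The same holds with `x₀` and `x₃` exchanged,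
and `profileTP_transversal` shows that one of the two choices always works.

Off the apex, polar coordinates are conformal with metric `(s² / 4)(ds² + dθ²)`, and an explicit
normal gives mean curvature one.

For analytic completeness, `x₃` is even in `s`, hence an entire function of `s² = 4(x₁² + x₂²)`. The
resulting equation cuts out exactly the image: in `S³₁` it fixes `x₀` up to sign, and both signs
occur because `x₀` is odd. Along an analytic curve the identity theorem propagates the equation. -/

theorem isConeAnalytic_of_analyticOnNhd_univ {m k : ℕ} {U : Set (DoubleCone m)}
    {μ : DoubleCone m → Fin k → ℝ} {g : (Fin (m + 1) → ℝ) → Fin k → ℝ} (hU : IsOpen U)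
    (hg : AnalyticOnNhd ℝ g univ) (h : ∀ x ∈ U, g x = μ x) : IsConeAnalytic U μ := by
  obtain ⟨Ω, hΩ, rfl⟩ := isOpen_induced_iff.mp hU
  exact ⟨Ω, g, hΩ, hg.mono (subset_univ _), fun _ => Iff.rfl, h⟩

theorem analyticTransition_of_eqOn {m : ℕ} {X : Type*} [TopologicalSpace X]
    {φ ψ : OpenPartialHomeomorph X (DoubleCone m)}
    (h : ∀ q ∈ φ.source, ψ q = φ q) : AnalyticTransition φ ψ := by
  refine isConeAnalytic_of_analyticOnNhd_univ (φ.symm.trans ψ).open_source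
    (g := fun x => x) analyticOnNhd_id fun x hx => ?_
  have hx' : x ∈ φ.target := by
    have := hx
    simp only [mfld_simps] at this
    exact this.1
  rw [h _ (φ.map_target hx'), φ.right_inv hx']

theorem mem_doubleCone_two {x : Fin 3 → ℝ} :
    x ∈ doubleCone 2 ↔ x 0 ^ 2 + x 1 ^ 2 = x 2 ^ 2 := by
  simp [doubleCone, Fin.sum_univ_two, Fin.last]

theorem smul_mem_doubleCone {m : ℕ} {x : Fin (m + 1) → ℝ} (hx : x ∈ doubleCone m) (t : ℝ) :
    t • x ∈ doubleCone m := by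
  have hx' : ∑ j : Fin m, x j.castSucc ^ 2 = x (Fin.last m) ^ 2 := hx
  change ∑ j : Fin m, (t • x) j.castSucc ^ 2 = (t • x) (Fin.last m) ^ 2
  simp only [Pi.smul_apply, smul_eq_mul, mul_pow, ← Finset.mul_sum, hx']

theorem isConnected_doubleCone (m : ℕ) : IsConnected (doubleCone m) := by
  have h0 : (0 : Fin (m + 1) → ℝ) ∈ doubleCone m := by simp [doubleCone]
  refine (StarConvex.isPathConnected (a := 0) ?_ h0).isConnected
  intro y hy a b _ _ _
  simpa using smul_mem_doubleCone hy b

theorem isClosed_surfaceTP : IsClosed surfaceTP :=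
  isClosed_eq (by fun_prop) (by fun_prop)

theorem isClosed_deSitter : IsClosed deSitter :=
  isClosed_eq (by unfold lorentz; fun_prop) continuous_const

/-! ### The charts of `X_TP` -/

/-- The global chart of `X_TP`. -/
def globalChartTP : OpenPartialHomeomorph surfaceTP (DoubleCone 2) :=
  coneChartTP.toOpenPartialHomeomorph

theorem mem_atlas_TP {φ : OpenPartialHomeomorph surfaceTP (DoubleCone 2)} :
    φ ∈ atlas (DoubleCone 2) surfaceTP ↔ φ = globalChartTP :=
  Iff.rfl

theorem isDCCoordinate_globalChartTP_restr {W : Set surfaceTP} (hW : IsOpen W) :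
    IsDCCoordinate (globalChartTP.restrOpen W hW) := by
  intro φ hφ
  rw [mem_atlas_TP.mp hφ]
  exact ⟨analyticTransition_of_eqOn fun _ _ => rfl, analyticTransition_of_eqOn fun _ _ => rfl⟩

theorem isDCCoordinate_globalChartTP : IsDCCoordinate globalChartTP := by
  intro φ hφ
  rw [mem_atlas_TP.mp hφ]
  exact ⟨analyticTransition_of_eqOn fun _ _ => rfl, analyticTransition_of_eqOn fun _ _ => rfl⟩

theorem isDCManifold_surfaceTP : IsDCManifold 2 surfaceTP where
  two_le := le_rfl
  locallyCompact := isClosed_surfaceTP.isClosedEmbedding_subtypeVal.locallyCompactSpace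
  hausdorff := inferInstance
  secondCountable := inferInstance
  connected_target := by
    intro φ hφ
    rw [mem_atlas_TP.mp hφ]
    have : ConnectedSpace (DoubleCone 2) := isConnected_iff_connectedSpace.mp (isConnected_doubleCone 2)
    exact isConnected_univ
  compatible := by
    intro φ hφ ψ hψ
    rw [mem_atlas_TP.mp hφ, mem_atlas_TP.mp hψ]
    exact analyticTransition_of_eqOn fun _ _ => rfl

theorem connectedSpace_surfaceTP : ConnectedSpace surfaceTP := by
  have : ConnectedSpace (DoubleCone 2) := isConnected_iff_connectedSpace.mp (isConnected_doubleCone 2)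
  exact coneChartTP.symm.surjective.connectedSpace coneChartTP.symm.continuous

theorem coneChartTP_eq_zero_iff (p : surfaceTP) :
    (coneChartTP p : Fin 3 → ℝ) = 0 ↔ (p : Fin 3 → ℝ) = 0 := by
  have h : (coneChartTP p : Fin 3 → ℝ) = ![p.1 0, p.1 1, p.1 2 / 2] := rfl
  rw [h, funext_iff, funext_iff, Fin.forall_fin_succ, Fin.forall_fin_two, Fin.forall_fin_succ,
    Fin.forall_fin_two]
  simp

/-! ### The apex is intrinsic -/

theorem hasFDerivAt_cone_quadric (a : Fin 3 → ℝ) :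
    HasFDerivAt (fun x : Fin 3 → ℝ => x 0 ^ 2 + x 1 ^ 2 - x 2 ^ 2)
      ((2 * a 0) • ContinuousLinearMap.proj (R := ℝ) (φ := fun _ : Fin 3 => ℝ) 0 +
        (2 * a 1) • ContinuousLinearMap.proj (R := ℝ) (φ := fun _ : Fin 3 => ℝ) 1 -
        (2 * a 2) • ContinuousLinearMap.proj (R := ℝ) (φ := fun _ : Fin 3 => ℝ) 2) a := by
  have h : ∀ i : Fin 3, HasFDerivAt (fun x : Fin 3 → ℝ => x i ^ 2)
      ((2 * a i) • ContinuousLinearMap.proj (R := ℝ) (φ := fun _ : Fin 3 => ℝ) i) a := fun i => by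
    simpa using (hasFDerivAt_apply (𝕜 := ℝ) i a).pow 2
  exact ((h 0).add (h 1)).sub (h 2)

/-- The cone vectors span `ℝ³`. -/
theorem linearMap_eq_of_eqOn_doubleCone {F : Type*} [AddCommGroup F] [Module ℝ F]
    {A B : (Fin 3 → ℝ) →ₗ[ℝ] F} (h : ∀ v ∈ doubleCone 2, A v = B v) : A = B := by
  have h1 := h ![1, 0, 1] (mem_doubleCone_two.mpr (by simp))
  have h2 := h ![-1, 0, 1] (mem_doubleCone_two.mpr (by simp))
  have h3 := h ![0, 1, 1] (mem_doubleCone_two.mpr (by simp))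
  have e2 : A ![0, 0, 1] = B ![0, 0, 1] := by
    have : (![0, 0, 1] : Fin 3 → ℝ) = (1 / 2 : ℝ) • (![1, 0, 1] + ![-1, 0, 1]) := by
      ext i; fin_cases i <;> norm_num
    rw [this, map_smul, map_smul, map_add, map_add, h1, h2]
  refine LinearMap.ext fun x => ?_
  have hx : x = x 0 • (![1, 0, 1] - ![0, 0, 1]) + x 1 • (![0, 1, 1] - ![0, 0, 1]) +
      x 2 • ![0, 0, 1] := by
    ext i; fin_cases i <;> simp
  rw [hx]
  simp only [map_add, map_smul, map_sub, h1, h3, e2]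

/-- A coordinate change of the double cone that is analytic together with its inverse and is
defined at the apex fixes the apex. -/
theorem eq_zero_of_analytic_local_inverse_at_apex {g h : (Fin 3 → ℝ) → Fin 3 → ℝ}
    {Ω : Set (Fin 3 → ℝ)} (hΩ : IsOpen Ω) (h0 : (0 : Fin 3 → ℝ) ∈ Ω)
    (hg : DifferentiableAt ℝ g 0) (hh : DifferentiableAt ℝ h (g 0))
    (hcone : ∀ x ∈ doubleCone 2, x ∈ Ω → g x ∈ doubleCone 2)
    (hinv : ∀ x ∈ doubleCone 2, x ∈ Ω → h (g x) = x) : g 0 = 0 := by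
  set a := g 0 with ha
  set L := fderiv ℝ g 0
  set M := fderiv ℝ h a
  -- The hypotheses on `g` and `h` hold only on the cone, so derivatives are compared along the
  -- lines `t • v` with `v` in the cone, which stay in it.
  have hline : ∀ v : Fin 3 → ℝ, HasDerivAt (fun t : ℝ => t • v) v 0 := fun v => by
    simpa using (hasDerivAt_id (0 : ℝ)).smul_const v
  have hgl : ∀ v : Fin 3 → ℝ, HasDerivAt (fun t : ℝ => g (t • v)) (L v) 0 := fun v =>
    HasFDerivAt.comp_hasDerivAt_of_eq (0 : ℝ) hg.hasFDerivAt (hline v) (by simp)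
  have hev : ∀ v : Fin 3 → ℝ, ∀ᶠ t : ℝ in nhds 0, t • v ∈ Ω := fun v =>
    (hline v).continuousAt.eventually (by simpa using hΩ.mem_nhds h0)
  have hid : ∀ v ∈ doubleCone 2, M (L v) = v := fun v hv => by
    have h1 : HasDerivAt (fun t : ℝ => h (g (t • v))) (M (L v)) 0 :=
      HasFDerivAt.comp_hasDerivAt_of_eq (0 : ℝ) hh.hasFDerivAt (hgl v) (by simp [ha])
    refine h1.unique ((hline v).congr_of_eventuallyEq ?_)
    filter_upwards [hev v] with t ht using hinv _ (smul_mem_doubleCone hv t) ht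
  have hML : (M : (Fin 3 → ℝ) →ₗ[ℝ] Fin 3 → ℝ) ∘ₗ (L : (Fin 3 → ℝ) →ₗ[ℝ] Fin 3 → ℝ) =
      LinearMap.id := linearMap_eq_of_eqOn_doubleCone hid
  have hinj : Function.Injective (L : (Fin 3 → ℝ) →ₗ[ℝ] Fin 3 → ℝ) :=
    Function.LeftInverse.injective (g := M) fun x => LinearMap.congr_fun hML x
  have hsurj := LinearMap.surjective_of_injective hinj
  have hQ := hasFDerivAt_cone_quadric a
  set D := (2 * a 0) • ContinuousLinearMap.proj (R := ℝ) (φ := fun _ : Fin 3 => ℝ) 0 +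
        (2 * a 1) • ContinuousLinearMap.proj (R := ℝ) (φ := fun _ : Fin 3 => ℝ) 1 -
        (2 * a 2) • ContinuousLinearMap.proj (R := ℝ) (φ := fun _ : Fin 3 => ℝ) 2 with hD
  have hzero : ∀ v ∈ doubleCone 2, D (L v) = 0 := fun v hv => by
    have h1 := HasFDerivAt.comp_hasDerivAt_of_eq (0 : ℝ) hQ (hgl v) (by simp [ha])
    refine h1.unique ((hasDerivAt_const (0 : ℝ) (0 : ℝ)).congr_of_eventuallyEq ?_)
    filter_upwards [hev v] with t ht
    have := mem_doubleCone_two.mp (hcone _ (smul_mem_doubleCone hv t) ht)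
    simp only [Function.comp_apply]
    linarith
  have hDL : (D : (Fin 3 → ℝ) →ₗ[ℝ] ℝ) ∘ₗ (L : (Fin 3 → ℝ) →ₗ[ℝ] Fin 3 → ℝ) = 0 :=
    linearMap_eq_of_eqOn_doubleCone hzero
  have hD0 : ∀ w, D w = 0 := fun w => by
    obtain ⟨v, rfl⟩ := hsurj w
    exact LinearMap.congr_fun hDL v
  have k0 := hD0 (Pi.single 0 1)
  have k1 := hD0 (Pi.single 1 1)
  have k2 := hD0 (Pi.single 2 1)
  simp [hD] at k0 k1 k2
  ext i
  fin_cases i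
  · exact k0
  · exact k1
  · exact k2

/-- If `ψ` sends `p` to the apex, then `g₂`, which extends the change from `ψ` to the global chart,
sends `0` to the global coordinates of `p`, and `g₁` extends the inverse change. So
`eq_zero_of_analytic_local_inverse_at_apex` applies. -/
theorem isDCPoint_surfaceTP_iff (p : surfaceTP) : IsDCPoint 2 p ↔ (p : Fin 3 → ℝ) = 0 := by
  constructor
  · rintro ⟨ψ, hψ, hp, hψp⟩
    obtain ⟨⟨Ω₁, g₁, -, hg₁, hΩ₁', hg₁'⟩, ⟨Ω₂, g₂, hΩ₂, hg₂, hΩ₂', hg₂'⟩⟩ :=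
      hψ globalChartTP (mem_atlas_TP.mpr rfl)
    have hsrc : ∀ x : DoubleCone 2, (x : Fin 3 → ℝ) ∈ Ω₂ ↔ x ∈ ψ.target := fun x => by
      rw [hΩ₂' x]
      simp [globalChartTP]
    have hsrc₁ : ∀ x : DoubleCone 2, (x : Fin 3 → ℝ) ∈ Ω₁ ↔ coneChartTP.symm x ∈ ψ.source :=
      fun x => by
      rw [hΩ₁' x]
      simp [globalChartTP]
    have hg₂v : ∀ x : DoubleCone 2, x ∈ ψ.target → g₂ x = coneChartTP (ψ.symm x) :=
      fun x hx => hg₂' x ((hΩ₂' x).mp ((hsrc x).mpr hx))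
    have hg₁v : ∀ q ∈ ψ.source, g₁ (coneChartTP q) = ψ q := fun q hq => by
      have hm : (coneChartTP q : Fin 3 → ℝ) ∈ Ω₁ := (hsrc₁ _).mpr (by simpa using hq)
      have := hg₁' _ ((hΩ₁' _).mp hm)
      simpa [globalChartTP] using this
    have ht : ψ p ∈ ψ.target := ψ.map_source hp
    have hval : g₂ 0 = coneChartTP p := by
      rw [← hψp, hg₂v _ ht, ψ.left_inv hp]
    have h0 : (0 : Fin 3 → ℝ) ∈ Ω₂ := hψp ▸ (hsrc _).mpr ht
    rw [← coneChartTP_eq_zero_iff, ← hval]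
    refine eq_zero_of_analytic_local_inverse_at_apex (h := g₁) hΩ₂ h0
      (hg₂ 0 h0).differentiableAt ?_ ?_ ?_
    · refine (hg₁ _ ?_).differentiableAt
      rw [hval]
      exact (hsrc₁ _).mpr (by simpa using hp)
    · intro x hx hxΩ
      rw [hg₂v ⟨x, hx⟩ ((hsrc ⟨x, hx⟩).mp hxΩ)]
      exact Subtype.property _
    · intro x hx hxΩ
      have hxt := (hsrc ⟨x, hx⟩).mp hxΩ
      rw [hg₂v ⟨x, hx⟩ hxt, hg₁v _ (ψ.map_target hxt), ψ.right_inv hxt]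
  · intro hp
    exact ⟨globalChartTP, isDCCoordinate_globalChartTP, mem_univ _,
      (coneChartTP_eq_zero_iff p).mpr hp⟩

/-! ### The image and properness -/

theorem fTP_eq (q : ℝ × Real.Angle) : fTP q = fTildeTP (toSurfaceTP q) :=
  Subtype.ext (rotation_profile_apply q.1 q.2)

theorem exists_angle_of_sq_add_sq_eq_one {x y : ℝ} (h : x ^ 2 + y ^ 2 = 1) :
    ∃ θ : Real.Angle, θ.cos = x ∧ θ.sin = y := by
  have hn : ‖(⟨x, y⟩ : ℂ)‖ = 1 := by
    rw [Complex.norm_def, Complex.normSq_mk, ← sq, ← sq, h, Real.sqrt_one]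
  refine ⟨Complex.arg ⟨x, y⟩, ?_, ?_⟩
  · rw [Real.Angle.cos_coe, Complex.cos_arg, hn, div_one]
    intro h0
    simp [h0] at hn
  · rw [Real.Angle.sin_coe, Complex.sin_arg, hn, div_one]

theorem surjective_toSurfaceTP : Function.Surjective toSurfaceTP := by
  intro p
  have hp : p.1 0 ^ 2 + p.1 1 ^ 2 = p.1 2 ^ 2 / 4 := p.2
  by_cases hs : p.1 2 = 0
  · refine ⟨(0, 0), Subtype.ext ?_⟩
    rw [hs] at hp
    have h0 : p.1 0 = 0 := by nlinarith [sq_nonneg (p.1 0), sq_nonneg (p.1 1)]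
    have h1 : p.1 1 = 0 := by nlinarith [sq_nonneg (p.1 0), sq_nonneg (p.1 1)]
    ext i
    fin_cases i <;> simp [toSurfaceTP, h0, h1, hs]
  · obtain ⟨θ, hc, hsn⟩ := exists_angle_of_sq_add_sq_eq_one
      (x := 2 * p.1 0 / p.1 2) (y := 2 * p.1 1 / p.1 2) (by field_simp; linarith)
    refine ⟨(p.1 2, θ), Subtype.ext ?_⟩
    ext i
    fin_cases i
    · simp [toSurfaceTP, hc]; field_simp
    · simp [toSurfaceTP, hsn]; field_simp
    · simp [toSurfaceTP]

theorem range_fTildeTP : Set.range fTildeTP = Set.range fTP := by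
  have h : fTP = fTildeTP ∘ toSurfaceTP := funext fTP_eq
  rw [h, surjective_toSurfaceTP.range_comp]

theorem continuous_fTildeTP : Continuous fTildeTP := by
  refine Continuous.subtype_mk ?_ _
  have h : ∀ i, Continuous fun p : surfaceTP => p.1 i := fun i =>
    (continuous_apply i).comp continuous_subtype_val
  have h0 := h 0
  have h1 := h 1
  have h2 := h 2
  refine continuous_pi fun i => ?_
  fin_cases i
  · change Continuous fun p : surfaceTP => x0TP (p.1 2)
    unfold x0TP
    exact (Real.continuous_sinh.comp h2).sub ((h2.div_const 2).mul (Real.continuous_cosh.comp h2))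
  · exact h0
  · exact h1
  · change Continuous fun p : surfaceTP => x3TP (p.1 2)
    unfold x3TP
    exact (Real.continuous_cosh.comp h2).sub ((h2.div_const 2).mul (Real.continuous_sinh.comp h2))

theorem isProperMap_fTildeTP : IsProperMap fTildeTP := by
  have : LocallyCompactSpace deSitter :=
    isClosed_deSitter.isClosedEmbedding_subtypeVal.locallyCompactSpace
  refine isProperMap_iff_isCompact_preimage.mpr ⟨continuous_fTildeTP, fun K hK => ?_⟩
  obtain ⟨R, hR⟩ := (hK.image continuous_subtype_val).isBounded.exists_norm_le
  have hball : IsCompact ((↑) ⁻¹' Metric.closedBall (0 : Fin 3 → ℝ) (4 * R) : Set surfaceTP) :=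
    isClosed_surfaceTP.isClosedEmbedding_subtypeVal.isCompact_preimage
      (isCompact_closedBall _ _)
  refine hball.of_isClosed_subset (hK.isClosed.preimage continuous_fTildeTP) fun p hp => ?_
  have hn : ‖(fTildeTP p : Fin 4 → ℝ)‖ ≤ R := hR _ ⟨_, hp, rfl⟩
  have hR0 : 0 ≤ R := (norm_nonneg _).trans hn
  have h0 : |p.1 0| ≤ R := (norm_le_pi_norm (fTildeTP p : Fin 4 → ℝ) 1).trans hn
  have h1 : |p.1 1| ≤ R := (norm_le_pi_norm (fTildeTP p : Fin 4 → ℝ) 2).trans hn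
  have hp2 : p.1 0 ^ 2 + p.1 1 ^ 2 = p.1 2 ^ 2 / 4 := p.2
  -- Bounding `ξ` and `η` suffices: the cone equation gives `s² = 4(ξ² + η²) ≤ 8R²`.
  have h2 : |p.1 2| ≤ 4 * R := by
    refine abs_le_of_sq_le_sq ?_ (by positivity)
    have := sq_le_sq' (abs_le.mp h0).1 (abs_le.mp h0).2
    have := sq_le_sq' (abs_le.mp h1).1 (abs_le.mp h1).2
    nlinarith
  rw [mem_preimage, mem_closedBall_zero_iff, pi_norm_le_iff_of_nonneg (by positivity)]
  intro i
  fin_cases i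
  · exact h0.trans (by linarith)
  · exact h1.trans (by linarith)
  · exact h2

/-! ### Regularity of the immersion -/

theorem hasDerivAt_half (s : ℝ) : HasDerivAt (fun t : ℝ => t / 2) (1 / 2) s :=
  (hasDerivAt_id s).div_const 2

theorem hasDerivAt_x0TP (s : ℝ) :
    HasDerivAt x0TP (1 / 2 * Real.cosh s - s / 2 * Real.sinh s) s := by
  convert! (Real.hasDerivAt_sinh s).sub ((hasDerivAt_half s).mul (Real.hasDerivAt_cosh s)) using 1
  ring

theorem hasDerivAt_x3TP (s : ℝ) :
    HasDerivAt x3TP (1 / 2 * Real.sinh s - s / 2 * Real.cosh s) s := by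
  convert! (Real.hasDerivAt_cosh s).sub ((hasDerivAt_half s).mul (Real.hasDerivAt_sinh s)) using 1
  ring

theorem analyticAt_x0TP (s : ℝ) : AnalyticAt ℝ x0TP s :=
  Real.analyticAt_sinh.sub (analyticAt_id.div_const.mul Real.analyticAt_cosh)

theorem analyticAt_x3TP (s : ℝ) : AnalyticAt ℝ x3TP s :=
  Real.analyticAt_cosh.sub (analyticAt_id.div_const.mul Real.analyticAt_sinh)

/-- One-dimensional analytic inverse function theorem. -/
theorem exists_openPartialHomeomorph_analytic_symm {u : ℝ → ℝ} (hu : ∀ t, AnalyticAt ℝ u t)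
    {s : ℝ} (hs : deriv u s ≠ 0) :
    ∃ e : OpenPartialHomeomorph ℝ ℝ, s ∈ e.source ∧ (∀ t, e t = u t) ∧
      AnalyticOnNhd ℝ e.symm e.target := by
  have hcont : Continuous (deriv u) := continuous_iff_continuousAt.mpr fun t =>
    (hu t).deriv.continuousAt
  have hopen : IsOpen {t | deriv u t ≠ 0} := isOpen_ne_fun hcont continuous_const
  have hder : ∀ t (ht : deriv u t ≠ 0), HasStrictFDerivAt u
      (ContinuousLinearEquiv.unitsEquivAut ℝ (Units.mk0 _ ht) : ℝ →L[ℝ] ℝ) t := fun t ht => by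
    convert! (hu t).hasStrictDerivAt.hasStrictFDerivAt using 1
  -- Restricting to `deriv u ≠ 0` makes the inverse analytic on the whole target, not only at `u s`.
  refine ⟨((hder s hs).toOpenPartialHomeomorph u).restrOpen _ hopen,
    ⟨(hder s hs).mem_toOpenPartialHomeomorph_source, hs⟩, fun _ => rfl, fun y hy => ?_⟩
  have ht := OpenPartialHomeomorph.map_target _ hy
  exact OpenPartialHomeomorph.analyticAt_symm _ hy (hu _) (hder _ ht.2).hasFDerivAt.fderiv

/-- If near `p` the de Sitter space is a graph of the coordinate `xⱼ` over the other ones and `xᵢ`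
is a regular function of `s`, then `f̃_TP` is regular at `p`. -/
theorem isDCRegularPoint_of_graph {i j : Fin 4} {ε : ℝ} {u y : ℝ → ℝ}
    (hij : i = 0 ∧ j = 3 ∨ i = 3 ∧ j = 0)
    (hN : ∀ x : Fin 4 → ℝ, x ∈ deSitter ↔ x j ^ 2 = x i ^ 2 + ε * (1 - x 1 ^ 2 - x 2 ^ 2))
    (hfu : ∀ p, (fTildeTP p : Fin 4 → ℝ) i = u (p.1 2))
    (hfy : ∀ p, (fTildeTP p : Fin 4 → ℝ) j = y (p.1 2))
    (hu : ∀ t, AnalyticAt ℝ u t) (hy : Continuous y) (p : surfaceTP)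
    (hu' : deriv u (p.1 2) ≠ 0) (hyp : y (p.1 2) ≠ 0) : IsDCRegularPoint 2 3 fTildeTP p := by
  obtain ⟨e, hes, heu, he⟩ := exists_openPartialHomeomorph_analytic_symm hu hu'
  -- `σ` is the sign of `xⱼ` at the point; it selects the branch of the square root.
  obtain ⟨σ, hσ, hσy⟩ : ∃ σ : ℝ, σ ^ 2 = 1 ∧ 0 < σ * y (p.1 2) := by
    rcases hyp.lt_or_gt with h | h
    · exact ⟨-1, by norm_num, by linarith⟩
    · exact ⟨1, by norm_num, by linarith⟩
  have hs : Continuous fun q : surfaceTP => q.1 2 :=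
    (continuous_apply 2).comp continuous_subtype_val
  have hW : IsOpen {q : surfaceTP | q.1 2 ∈ e.source ∧ 0 < σ * y (q.1 2)} :=
    (e.open_source.preimage hs).inter
      (isOpen_lt continuous_const (continuous_const.mul (hy.comp hs)))
  have huc : Continuous u := continuous_iff_continuousAt.mpr fun t => (hu t).continuousAt
  -- `R` is `xⱼ²` on `S³₁` in the coordinates `z = (x₁, x₂, s / 2)`.
  set R : (Fin 3 → ℝ) → ℝ := fun z => u (2 * z 2) ^ 2 + ε * (1 - z 0 ^ 2 - z 1 ^ 2) with hR
  have hRc : Continuous R := by fun_prop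
  obtain ⟨Ψ, hΨi, hΨj, hΨ1, hΨ2⟩ : ∃ Ψ : (Fin 3 → ℝ) → Fin 4 → ℝ,
      (∀ z, Ψ z i = u (2 * z 2)) ∧ (∀ z, Ψ z j = σ * √(R z)) ∧ (∀ z, Ψ z 1 = z 0) ∧
        ∀ z, Ψ z 2 = z 1 := by
    rcases hij with ⟨rfl, rfl⟩ | ⟨rfl, rfl⟩
    · exact ⟨fun z => ![u (2 * z 2), z 0, z 1, σ * √(R z)], fun _ => rfl, fun _ => rfl,
        fun _ => rfl, fun _ => rfl⟩
    · exact ⟨fun z => ![σ * √(R z), z 0, z 1, u (2 * z 2)], fun _ => rfl, fun _ => rfl,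
        fun _ => rfl, fun _ => rfl⟩
  have hall : ∀ P : Fin 4 → Prop, P i → P j → P 1 → P 2 → ∀ l, P l := fun P hi hj h1 h2 l => by
    rcases hij with ⟨rfl, rfl⟩ | ⟨rfl, rfl⟩ <;> fin_cases l <;> assumption
  have hproj : ∀ {n : ℕ} (l : Fin n) (x : Fin n → ℝ), AnalyticAt ℝ (fun x => x l) x :=
    fun l x => (ContinuousLinearMap.proj (R := ℝ) (φ := fun _ => ℝ) l).analyticAt x
  have hua : ∀ z : Fin 3 → ℝ, AnalyticAt ℝ (fun z : Fin 3 → ℝ => u (2 * z 2)) z := fun z =>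
    (hu _).comp (analyticAt_const.mul (hproj 2 z))
  refine ⟨globalChartTP.restrOpen _ hW, isDCCoordinate_globalChartTP_restr hW,
    ⟨mem_univ _, hes, hσy⟩, {x | x i ∈ e.target ∧ 0 < σ * x j},
    fun x => ![x 1, x 2, e.symm (x i) / 2],
    ⟨?_, ?_, {z | 2 * z 2 ∈ e.source ∧ 0 < R z}, Ψ, ?_, ?_, ?_, ?_, ?_, ?_⟩, ?_, ?_⟩
  · exact (e.open_target.preimage (continuous_apply i)).inter
      (isOpen_lt continuous_const (continuous_const.mul (continuous_apply j)))
  · intro x hx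
    refine AnalyticAt.pi fun l => ?_
    fin_cases l
    · exact hproj 1 x
    · exact hproj 2 x
    · exact (AnalyticAt.comp (f := fun x : Fin 4 → ℝ => x i) (he _ hx.1) (hproj i x)).div_const
  · exact (e.open_source.preimage (continuous_const.mul (continuous_apply 2))).inter
      (isOpen_lt continuous_const hRc)
  · intro z hz
    refine AnalyticAt.pi (hall _ ?_ ?_ ?_ ?_)
    · simpa only [hΨi] using hua z
    · simp only [hΨj]
      have hRa : AnalyticAt ℝ R z := ((hua z).pow 2).add (analyticAt_const.mul
        ((analyticAt_const.sub ((hproj 0 z).pow 2)).sub ((hproj 1 z).pow 2)))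
      exact analyticAt_const.mul
        ((Real.contDiffAt_sqrt hz.2.ne').analyticAt.comp hRa)
    · simpa only [hΨ1] using hproj 0 z
    · simpa only [hΨ2] using hproj 1 z
  · rintro x ⟨hxN, hx⟩
    have hxj : x j ≠ 0 := fun h => by simpa [h] using hx.2
    have h2 : 2 * (e.symm (x i) / 2) = e.symm (x i) := by ring
    refine ⟨?_, ?_⟩
    · change 2 * (e.symm (x i) / 2) ∈ e.source
      rw [h2]
      exact e.map_target hx.1
    · change 0 < u (2 * (e.symm (x i) / 2)) ^ 2 + ε * (1 - x 1 ^ 2 - x 2 ^ 2)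
      rw [h2, ← heu, e.right_inv hx.1, ← (hN x).mp hxN]
      positivity
  · rintro z ⟨hz1, hz2⟩
    refine ⟨(hN _).mpr ?_, ?_, ?_⟩
    · rw [hΨj, hΨi, hΨ1, hΨ2, mul_pow, hσ, Real.sq_sqrt hz2.le, one_mul]
    · rw [hΨi, ← heu]
      exact e.map_source hz1
    · rw [hΨj, ← mul_assoc, ← sq, hσ, one_mul]
      exact Real.sqrt_pos.mpr hz2
  · rintro x ⟨hxN, hx⟩
    have h2 : 2 * (e.symm (x i) / 2) = e.symm (x i) := by ring
    refine funext (hall _ ?_ ?_ ?_ ?_)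
    · rw [hΨi]
      change u (2 * (e.symm (x i) / 2)) = x i
      rw [h2, ← heu, e.right_inv hx.1]
    · rw [hΨj]
      change σ * √(u (2 * (e.symm (x i) / 2)) ^ 2 + ε * (1 - x 1 ^ 2 - x 2 ^ 2)) = x j
      rw [h2, ← heu, e.right_inv hx.1, ← (hN x).mp hxN, ← one_mul (x j ^ 2), ← hσ, ← mul_pow,
        Real.sqrt_sq hx.2.le, ← mul_assoc, ← sq, hσ, one_mul]
    · rw [hΨ1]; rfl
    · rw [hΨ2]; rfl
  · rintro z ⟨hz1, hz2⟩
    change ![Ψ z 1, Ψ z 2, e.symm (Ψ z i) / 2] = z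
    rw [hΨi, hΨ1, hΨ2, ← heu, e.left_inv hz1]
    ext l
    fin_cases l
    · rfl
    · rfl
    · change 2 * z 2 / 2 = z 2
      ring
  · rintro q ⟨-, hq1, hq2⟩
    refine ⟨?_, ?_⟩
    · rw [hfu, ← heu]
      exact e.map_source hq1
    · rw [hfy]
      exact hq2
  · intro a ha l
    have hq := (OpenPartialHomeomorph.map_target _ ha).2
    have h2 : e.symm ((fTildeTP (coneChartTP.symm a) : Fin 4 → ℝ) i) = 2 * a.1 2 := by
      rw [hfu, ← heu]
      exact e.left_inv hq.1
    -- Here `n = m + 1 = 3`, so there are no trailing zero coordinates.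
    rw [dif_pos l.isLt]
    change ![a.1 0, a.1 1, e.symm ((fTildeTP (coneChartTP.symm a) : Fin 4 → ℝ) i) / 2] l = a.1 l
    rw [h2]
    fin_cases l
    · rfl
    · rfl
    · change 2 * a.1 2 / 2 = a.1 2
      ring

/-- Failure of both alternatives leaves four cases, each a pair of linear equations in `(cosh s,
sinh s)`. Since `cosh s > 0`, the determinant vanishes, which forces `s²` to be `4`, `2`, `2` or
`1`. All contradict `cosh² - sinh² = 1` directly except `x₀ = x₀' = 0`, where `sinh² s = 1` is
excluded by `s² ≤ sinh² s`. -/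
theorem profileTP_transversal (s : ℝ) :
    x3TP s ≠ 0 ∧ 1 / 2 * Real.cosh s - s / 2 * Real.sinh s ≠ 0 ∨
      x0TP s ≠ 0 ∧ 1 / 2 * Real.sinh s - s / 2 * Real.cosh s ≠ 0 := by
  unfold x0TP x3TP
  have hcs := Real.cosh_sq s
  have hc := Real.cosh_pos s
  have hsh : s ^ 2 ≤ Real.sinh s ^ 2 := by
    rw [sq_le_sq, Real.abs_sinh]
    exact Real.self_le_sinh_iff.mpr (abs_nonneg s)
  generalize Real.cosh s = c at *
  generalize Real.sinh s = d at *
  by_contra! h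
  by_cases h3 : c - s / 2 * d = 0
  · by_cases h0 : d - s / 2 * c = 0
    · have : c * (1 - s ^ 2 / 4) = 0 := by linear_combination h3 + s / 2 * h0
      have hs : 1 - s ^ 2 / 4 = 0 := (mul_eq_zero.mp this).resolve_left hc.ne'
      have : c ^ 2 = d ^ 2 := by
        linear_combination (c + s / 2 * d) * h3 - d ^ 2 * hs
      linarith
    · have h1 := h.2 h0
      have : c * (1 - s ^ 2 / 2) = 0 := by linear_combination h3 + s * h1
      have hs : 1 - s ^ 2 / 2 = 0 := (mul_eq_zero.mp this).resolve_left hc.ne'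
      have : d ^ 2 = 2 * c ^ 2 := by
        linear_combination 2 * (d + s * c) * h1 - 2 * c ^ 2 * hs
      nlinarith
  · have h1 := h.1 h3
    by_cases h0 : d - s / 2 * c = 0
    · have : c * (1 - s ^ 2 / 2) = 0 := by linear_combination 2 * h1 + s * h0
      have hs : 1 - s ^ 2 / 2 = 0 := (mul_eq_zero.mp this).resolve_left hc.ne'
      have : c ^ 2 = 2 * d ^ 2 := by
        linear_combination 2 * (c + s * d) * h1 - 2 * d ^ 2 * hs
      nlinarith
    · have h2 := h.2 h0
      have : c * (1 - s ^ 2) = 0 := by linear_combination 2 * h1 + 2 * s * h2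
      have hs : 1 - s ^ 2 = 0 := (mul_eq_zero.mp this).resolve_left hc.ne'
      have : c ^ 2 = d ^ 2 := by
        linear_combination 2 * (c + s * d) * h1 - d ^ 2 * hs
      linarith

theorem isDCRegularPoint_fTildeTP (p : surfaceTP) : IsDCRegularPoint 2 3 fTildeTP p := by
  have hc : ∀ {u : ℝ → ℝ}, (∀ t, AnalyticAt ℝ u t) → Continuous u := fun hu =>
    continuous_iff_continuousAt.mpr fun t => (hu t).continuousAt
  rcases profileTP_transversal (p.1 2) with ⟨h, h'⟩ | ⟨h, h'⟩
  · refine isDCRegularPoint_of_graph (i := 0) (j := 3) (ε := 1) (Or.inl ⟨rfl, rfl⟩)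
      (fun x => ?_) (fun _ => rfl) (fun _ => rfl) analyticAt_x0TP (hc analyticAt_x3TP) p ?_ h
    · change lorentz x x = 1 ↔ _
      unfold lorentz
      constructor <;> intro hx <;> linear_combination hx
    · rwa [(hasDerivAt_x0TP _).deriv]
  · refine isDCRegularPoint_of_graph (i := 3) (j := 0) (ε := -1) (Or.inr ⟨rfl, rfl⟩)
      (fun x => ?_) (fun _ => rfl) (fun _ => rfl) analyticAt_x3TP (hc analyticAt_x0TP) p ?_ h
    · change lorentz x x = 1 ↔ _
      unfold lorentz
      constructor <;> intro hx <;> linear_combination -hx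
    · rwa [(hasDerivAt_x3TP _).deriv]

theorem isDCAnalytic_fTildeTP : IsDCAnalytic 2 fTildeTP := by
  intro φ hφ
  rw [mem_atlas_TP.mp hφ]
  refine isConeAnalytic_of_analyticOnNhd_univ globalChartTP.open_target
    (g := fun z : Fin 3 → ℝ => ![x0TP (2 * z 2), z 0, z 1, x3TP (2 * z 2)]) ?_ fun _ _ => rfl
  intro z _
  have hproj : ∀ l : Fin 3, AnalyticAt ℝ (fun x : Fin 3 → ℝ => x l) z :=
    fun l => (ContinuousLinearMap.proj (R := ℝ) (φ := fun _ => ℝ) l).analyticAt z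
  refine AnalyticAt.pi fun l => ?_
  fin_cases l
  · exact (analyticAt_x0TP _).comp (analyticAt_const.mul (hproj 2))
  · exact hproj 0
  · exact hproj 1
  · exact (analyticAt_x3TP _).comp (analyticAt_const.mul (hproj 2))

theorem isDCImmersion_fTildeTP : IsDCImmersion 2 3 fTildeTP :=
  ⟨by norm_num, isDCAnalytic_fTildeTP, isDCRegularPoint_fTildeTP⟩

/-! ### Mean curvature -/

theorem hasFDerivAt_mul_separated {A B : ℝ → ℝ} {A' B' : ℝ} {w : Fin 2 → ℝ}
    (hA : HasDerivAt A A' (w 0)) (hB : HasDerivAt B B' (w 1)) :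
    HasFDerivAt (fun w : Fin 2 → ℝ => A (w 0) * B (w 1))
      ((A' * B (w 1)) • ContinuousLinearMap.proj (R := ℝ) (φ := fun _ : Fin 2 => ℝ) 0 +
        (A (w 0) * B') • ContinuousLinearMap.proj (R := ℝ) (φ := fun _ : Fin 2 => ℝ) 1) w := by
  have h0 := hA.comp_hasFDerivAt w (hasFDerivAt_apply (𝕜 := ℝ) (0 : Fin 2) w)
  have h1 := hB.comp_hasFDerivAt w (hasFDerivAt_apply (𝕜 := ℝ) (1 : Fin 2) w)
  convert! h0.mul h1 using 1
  ext v
  simp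
  ring

theorem partialD_apply {F : (Fin 2 → ℝ) → Fin 4 → ℝ} {D : Fin 4 → (Fin 2 → ℝ) →L[ℝ] ℝ}
    {w : Fin 2 → ℝ} (h : ∀ l, HasFDerivAt (fun w => F w l) (D l) w) (i : Fin 2) (l : Fin 4) :
    partialD i F w l = D l (Pi.single i 1) := by
  have hF : HasFDerivAt F (ContinuousLinearMap.pi D) w := hasFDerivAt_pi'.mpr h
  rw [partialD, hF.fderiv]
  rfl

/-- A map of separated form `(a(w₀), r(w₀) C(w₁), r(w₀) S(w₁), b(w₀))`. -/
def separatedMap (a r b C S : ℝ → ℝ) (w : Fin 2 → ℝ) : Fin 4 → ℝ :=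
  ![a (w 0), r (w 0) * C (w 1), r (w 0) * S (w 1), b (w 0)]

section

variable {a r b C S a' r' b' C' S' : ℝ → ℝ}

/-- Partial derivatives of separated maps are again separated, so the same lemma yields the second
derivatives. -/
theorem partialD_separatedMap (ha : ∀ t, HasDerivAt a (a' t) t) (hr : ∀ t, HasDerivAt r (r' t) t)
    (hb : ∀ t, HasDerivAt b (b' t) t) (hC : ∀ t, HasDerivAt C (C' t) t)
    (hS : ∀ t, HasDerivAt S (S' t) t) :
    partialD 0 (separatedMap a r b C S) = separatedMap a' r' b' C S ∧
      partialD 1 (separatedMap a r b C S) = separatedMap 0 r 0 C' S' := by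
  have hone : ∀ t : ℝ, HasDerivAt (fun _ : ℝ => (1 : ℝ)) 0 t := fun t => hasDerivAt_const t 1
  have h : ∀ w l, HasFDerivAt (fun w => separatedMap a r b C S w l)
      (![(a' (w 0) * 1) • ContinuousLinearMap.proj (R := ℝ) (φ := fun _ : Fin 2 => ℝ) 0 +
          (a (w 0) * 0) • ContinuousLinearMap.proj (R := ℝ) (φ := fun _ : Fin 2 => ℝ) 1,
        (r' (w 0) * C (w 1)) • ContinuousLinearMap.proj (R := ℝ) (φ := fun _ : Fin 2 => ℝ) 0 +
          (r (w 0) * C' (w 1)) • ContinuousLinearMap.proj (R := ℝ) (φ := fun _ : Fin 2 => ℝ) 1,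
        (r' (w 0) * S (w 1)) • ContinuousLinearMap.proj (R := ℝ) (φ := fun _ : Fin 2 => ℝ) 0 +
          (r (w 0) * S' (w 1)) • ContinuousLinearMap.proj (R := ℝ) (φ := fun _ : Fin 2 => ℝ) 1,
        (b' (w 0) * 1) • ContinuousLinearMap.proj (R := ℝ) (φ := fun _ : Fin 2 => ℝ) 0 +
          (b (w 0) * 0) • ContinuousLinearMap.proj (R := ℝ) (φ := fun _ : Fin 2 => ℝ) 1] l) w := by
    intro w l
    fin_cases l
    · simpa [separatedMap] using hasFDerivAt_mul_separated (ha (w 0)) (hone (w 1))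
    · exact hasFDerivAt_mul_separated (hr (w 0)) (hC (w 1))
    · exact hasFDerivAt_mul_separated (hr (w 0)) (hS (w 1))
    · simpa [separatedMap] using hasFDerivAt_mul_separated (hb (w 0)) (hone (w 1))
  constructor <;> ext w l <;> rw [partialD_apply (h w)] <;> fin_cases l <;> simp [separatedMap]

end

/-- The G-catenoid as a map on the universal cover of `ℝ × T¹`. -/
def catenoidTP : (Fin 2 → ℝ) → Fin 4 → ℝ :=
  separatedMap x0TP (fun s => s / 2) x3TP Real.cos Real.sin

theorem isSpacelikeCMCOneAt_catenoidTP {w : Fin 2 → ℝ} (hw : w 0 ≠ 0) :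
    IsSpacelikeCMCOneAt catenoidTP w := by
  have hsin' : ∀ t, HasDerivAt (fun t => -Real.sin t) (-Real.cos t) t := fun t =>
    (Real.hasDerivAt_sin t).neg
  have hzero : ∀ t : ℝ, HasDerivAt (0 : ℝ → ℝ) ((0 : ℝ → ℝ) t) t := fun t => hasDerivAt_const t 0
  have hhalf : ∀ t : ℝ, HasDerivAt (fun _ : ℝ => (1 / 2 : ℝ)) ((0 : ℝ → ℝ) t) t := fun t =>
    hasDerivAt_const t _
  have h0'' : ∀ t, HasDerivAt (fun s => 1 / 2 * Real.cosh s - s / 2 * Real.sinh s)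
      (-(t / 2) * Real.cosh t) t := fun t => by
    convert! ((Real.hasDerivAt_cosh t).const_mul (1 / 2)).sub
      ((hasDerivAt_half t).mul (Real.hasDerivAt_sinh t)) using 1
    ring
  have h3'' : ∀ t, HasDerivAt (fun s => 1 / 2 * Real.sinh s - s / 2 * Real.cosh s)
      (-(t / 2) * Real.sinh t) t := fun t => by
    convert! ((Real.hasDerivAt_sinh t).const_mul (1 / 2)).sub
      ((hasDerivAt_half t).mul (Real.hasDerivAt_cosh t)) using 1
    ring
  obtain ⟨d0, d1⟩ := partialD_separatedMap hasDerivAt_x0TP hasDerivAt_half hasDerivAt_x3TP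
    Real.hasDerivAt_cos Real.hasDerivAt_sin
  obtain ⟨d00, -⟩ := partialD_separatedMap h0'' hhalf h3'' Real.hasDerivAt_cos Real.hasDerivAt_sin
  obtain ⟨-, d11⟩ := partialD_separatedMap hzero hasDerivAt_half hzero hsin' Real.hasDerivAt_cos
  change partialD 0 catenoidTP = _ at d0
  change partialD 1 catenoidTP = _ at d1
  rw [← d0] at d00
  rw [← d1] at d11
  obtain ⟨s, hs⟩ : ∃ s, s = w 0 := ⟨_, rfl⟩
  obtain ⟨θ, hθ⟩ : ∃ θ, θ = w 1 := ⟨_, rfl⟩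
  rw [← hs] at hw
  have hcs := Real.cosh_sq s
  have htr := Real.sin_sq_add_cos_sq θ
  have g00 : firstForm catenoidTP 0 0 w = s ^ 2 / 4 := by
    rw [firstForm, d0]
    simp only [lorentz, separatedMap, Matrix.cons_val, ← hs, ← hθ]
    linear_combination (s ^ 2 / 4 - 1 / 4) * hcs + 1 / 4 * htr
  have g01 : firstForm catenoidTP 0 1 w = 0 := by
    rw [firstForm, d0, d1]
    simp only [lorentz, separatedMap, Matrix.cons_val, ← hs, ← hθ, Pi.zero_apply]
    ring
  have g11 : firstForm catenoidTP 1 1 w = s ^ 2 / 4 := by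
    rw [firstForm, d1]
    simp only [lorentz, separatedMap, Matrix.cons_val, ← hs, ← hθ, Pi.zero_apply]
    linear_combination s ^ 2 / 4 * htr
  refine ⟨?_, ?_, ?_, ?_⟩
  · have : s / 2 * Real.cos θ * (s / 2 * Real.cos θ) + s / 2 * Real.sin θ * (s / 2 * Real.sin θ) =
      s ^ 2 / 4 := by linear_combination s ^ 2 / 4 * htr
    have := mem_deSitter_TP (ξ := s / 2 * Real.cos θ) (η := s / 2 * Real.sin θ) (s := s)
      (by linear_combination this)
    simpa [catenoidTP, separatedMap, ← hs, ← hθ] using this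
  · rw [g00]; positivity
  · rw [g00, g01, g11]; ring_nf; positivity
  -- With `T = (sinh s, 0, 0, cosh s)`, `C = (cosh s, 0, 0, sinh s)` and `e` the radial unit vector,
  -- the normal is sought as `P C + B e - T`. Orthogonality to the position and to the
  -- `s`-derivative gives `P + B = 2 / s` and `P - B = s`; then its square is `1 - (P + B)(P - B) =
  -- -1`.
  set P := (1 + s ^ 2 / 2) / s with hP
  set B := (1 - s ^ 2 / 2) / s with hB
  have hPs : P * s = 1 + s ^ 2 / 2 := div_mul_cancel₀ _ hw
  have hBs : B = P - s := by rw [hB, hP]; field_simp; ring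
  refine ⟨![P * Real.cosh s - Real.sinh s, B * Real.cos θ, B * Real.sin θ,
    P * Real.sinh s - Real.cosh s], ?_, ?_, ?_, ?_⟩
  · simp only [lorentz, Matrix.cons_val]
    rw [hBs]
    linear_combination (1 - P ^ 2) * hcs + (P - s) ^ 2 * htr - 2 * hPs
  · simp only [lorentz, catenoidTP, separatedMap, Matrix.cons_val, ← hs, ← hθ, x0TP, x3TP]
    rw [hBs]
    linear_combination (P * s / 2 - 1) * hcs + (P - s) * (s / 2) * htr + hPs
  · intro i
    fin_cases i
    · change lorentz _ (partialD 0 catenoidTP w) = 0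
      rw [d0]
      simp only [lorentz, separatedMap, Matrix.cons_val, ← hs, ← hθ]
      rw [hBs]
      linear_combination (s / 2 - P / 2) * hcs + (P - s) / 2 * htr
    · change lorentz _ (partialD 1 catenoidTP w) = 0
      rw [d1]
      simp only [lorentz, separatedMap, Matrix.cons_val, ← hs, ← hθ, Pi.zero_apply]
      ring
  · rw [meanCurvature, g00, g01, g11, secondForm, secondForm, secondForm, d00, d11]
    simp only [lorentz, separatedMap, Matrix.cons_val, ← hs, ← hθ, Pi.zero_apply]
    rw [div_eq_one_iff_eq (by ring_nf; positivity), hBs]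
    linear_combination s ^ 2 / 4 * (s / 2 * P * hcs - s / 2 * (P - s) * htr)

/-- Polar parametrization of the cone. -/
def conePolar (w : Fin 2 → ℝ) : DoubleCone 2 :=
  ⟨![w 0 / 2 * Real.cos (w 1), w 0 / 2 * Real.sin (w 1), w 0 / 2], mem_doubleCone_two.mpr <| by
    simp only [Matrix.cons_val]
    linear_combination (w 0) ^ 2 / 4 * Real.sin_sq_add_cos_sq (w 1)⟩

theorem fTildeTP_conePolar (w : Fin 2 → ℝ) :
    (fTildeTP (coneChartTP.symm (conePolar w)) : Fin 4 → ℝ) = catenoidTP w := by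
  change ![x0TP (2 * (w 0 / 2)), w 0 / 2 * Real.cos (w 1), w 0 / 2 * Real.sin (w 1),
    x3TP (2 * (w 0 / 2))] = _
  rw [mul_div_cancel₀ _ two_ne_zero]
  rfl

theorem analyticOnNhd_conePolar (V : Set (Fin 2 → ℝ)) :
    AnalyticOnNhd ℝ (fun w => (conePolar w : Fin 3 → ℝ)) V := by
  intro w _
  have hproj : ∀ l : Fin 2, AnalyticAt ℝ (fun x : Fin 2 → ℝ => x l) w :=
    fun l => (ContinuousLinearMap.proj (R := ℝ) (φ := fun _ => ℝ) l).analyticAt w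
  refine AnalyticAt.pi fun l => ?_
  fin_cases l
  · exact (hproj 0).div_const.mul (Real.analyticAt_cos.comp (hproj 1))
  · exact (hproj 0).div_const.mul (Real.analyticAt_sin.comp (hproj 1))
  · exact (hproj 0).div_const

theorem injective_fderiv_conePolar {w : Fin 2 → ℝ} (hw : w 0 ≠ 0) :
    Function.Injective (fderiv ℝ (fun w => (conePolar w : Fin 3 → ℝ)) w) := by
  have hd := ((analyticOnNhd_conePolar univ) w (mem_univ _)).differentiableAt.hasFDerivAt
  have hd' := hasFDerivAt_pi'.mp hd
  have e0 := (hd' 0).unique (hasFDerivAt_mul_separated (hasDerivAt_half _) (Real.hasDerivAt_cos _))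
  have e1 := (hd' 1).unique (hasFDerivAt_mul_separated (hasDerivAt_half _) (Real.hasDerivAt_sin _))
  have e2 := (hd' 2).unique
    ((hasDerivAt_half _).comp_hasFDerivAt w (hasFDerivAt_apply (𝕜 := ℝ) (0 : Fin 2) w))
  rw [injective_iff_map_eq_zero]
  intro v hv
  have k0 := DFunLike.congr_fun e0 v
  have k1 := DFunLike.congr_fun e1 v
  have k2 := DFunLike.congr_fun e2 v
  simp [hv] at k0 k1 k2
  have v0 : v 0 = 0 := k2
  rw [v0] at k0 k1
  have v1 : w 0 * v 1 = 0 := by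
    linear_combination 2 * Real.sin (w 1) * k0 - 2 * Real.cos (w 1) * k1 -
      w 0 * v 1 * Real.sin_sq_add_cos_sq (w 1)
  ext l
  fin_cases l
  · exact v0
  · exact (mul_eq_zero.mp v1).resolve_left hw

theorem injOn_conePolar (s θ : ℝ) :
    InjOn conePolar {w | 0 < s * w 0 ∧ |w 1 - θ| < Real.pi} := by
  rintro w ⟨hw, hwθ⟩ w' ⟨-, hwθ'⟩ h
  have hv := congrArg Subtype.val h
  have e0 : w 0 / 2 * Real.cos (w 1) = w' 0 / 2 * Real.cos (w' 1) := congrFun hv 0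
  have e1 : w 0 / 2 * Real.sin (w 1) = w' 0 / 2 * Real.sin (w' 1) := congrFun hv 1
  have e2 : w 0 / 2 = w' 0 / 2 := congrFun hv 2
  have hw0 : w 0 / 2 ≠ 0 := by
    intro h0
    have : w 0 = 0 := by linarith
    simp [this] at hw
  rw [← e2] at e0 e1
  obtain ⟨n, hn⟩ := Real.Angle.angle_eq_iff_two_pi_dvd_sub.mp
    (Real.Angle.cos_sin_inj (mul_left_cancel₀ hw0 e0) (mul_left_cancel₀ hw0 e1))
  have hpi := Real.pi_pos
  -- Both angles lie in an open window of length `2π`, so they cannot differ by a non-zero multiple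
  -- of `2π`.
  have hn0 : n = 0 := by
    rw [abs_lt] at hwθ hwθ'
    have h1 : (n : ℝ) < 1 := by nlinarith
    have h2 : (-1 : ℝ) < n := by nlinarith
    have h1' : n < 1 := by exact_mod_cast h1
    have h2' : -1 < n := by exact_mod_cast h2
    omega
  rw [hn0] at hn
  ext l
  fin_cases l
  · change w 0 = w' 0
    linarith
  · change w 1 = w' 1
    simp at hn
    linarith

theorem isSpacelikeCMCOneDCImmersion_fTildeTP : IsSpacelikeCMCOneDCImmersion fTildeTP := by
  refine ⟨isDCManifold_surfaceTP, connectedSpace_surfaceTP, isDCImmersion_fTildeTP, fun p hp => ?_⟩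
  obtain ⟨⟨s, θ⟩, rfl⟩ := surjective_toSurfaceTP p
  have hs : s ≠ 0 := by
    rintro rfl
    refine hp ((isDCPoint_surfaceTP_iff _).mpr ?_)
    ext l
    fin_cases l <;> simp [toSurfaceTP]
  have hV : ∀ w ∈ {w : Fin 2 → ℝ | 0 < s * w 0 ∧ |w 1 - θ.toReal| < Real.pi}, w 0 ≠ 0 := by
    rintro w ⟨hw, -⟩ h0
    simp [h0] at hw
  refine ⟨globalChartTP, isDCCoordinate_globalChartTP, mem_univ _,
    {w | 0 < s * w 0 ∧ |w 1 - θ.toReal| < Real.pi}, conePolar, ?_, analyticOnNhd_conePolar _,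
    fun w hw => injective_fderiv_conePolar (hV w hw), injOn_conePolar s _,
    fun w hw => ⟨mem_univ _, fun h0 => hV w hw ?_⟩, ⟨![s, θ.toReal], ⟨?_, ?_⟩, Subtype.ext ?_⟩,
    fun w hw => ?_⟩
  · exact (isOpen_lt continuous_const (continuous_const.mul (continuous_apply 0))).inter
      (isOpen_lt ((continuous_apply 1).sub continuous_const).abs continuous_const)
  · have h2 : w 0 / 2 = 0 := congrFun h0 2
    linarith
  · exact mul_self_pos.mpr hs
  · change |θ.toReal - θ.toReal| < Real.pi
    simpa using Real.pi_pos
  · change ![s / 2 * Real.cos θ.toReal, s / 2 * Real.sin θ.toReal, s / 2] =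
      ![s / 2 * θ.cos, s / 2 * θ.sin, s / 2]
    rw [Real.Angle.cos_toReal, Real.Angle.sin_toReal]
  · have h : (fun w => (fTildeTP (globalChartTP.symm (conePolar w)) : Fin 4 → ℝ)) = catenoidTP :=
      funext fTildeTP_conePolar
    rw [h]
    exact isSpacelikeCMCOneAt_catenoidTP (hV w hw)

/-! ### Analytic completeness of the image -/

/-- The coefficients of the entire function `z ↦ ∑ zⁿ / (2n)!`, which is `cosh ∘ √` for `z ≥ 0`. -/
def coshSqrtCoeff (n : ℕ) : ℝ := ((2 * n).factorial : ℝ)⁻¹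

/-- The entire function `z ↦ ∑ zⁿ / (2n)!`, which is `cosh ∘ √` for `z ≥ 0`. -/
def coshSqrt : ℝ → ℝ := FormalMultilinearSeries.ofScalarsSum (E := ℝ) coshSqrtCoeff

theorem coshSqrt_sq (s : ℝ) : coshSqrt (s ^ 2) = Real.cosh s := by
  rw [coshSqrt, FormalMultilinearSeries.ofScalarsSum_eq_tsum, Real.cosh_eq_tsum]
  refine tsum_congr fun n => ?_
  rw [coshSqrtCoeff, smul_eq_mul, ← pow_mul]
  ring

theorem radius_coshSqrtCoeff :
    (FormalMultilinearSeries.ofScalars ℝ coshSqrtCoeff).radius = ⊤ := by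
  refine FormalMultilinearSeries.ofScalars_radius_eq_top_of_tendsto ℝ coshSqrtCoeff
    (Filter.Eventually.of_forall fun n => by unfold coshSqrtCoeff; positivity) ?_
  -- Ratio test: consecutive coefficients have ratio `1 / ((2n + 1)(2n + 2)) ≤ 1 / (n + 1)`.
  refine squeeze_zero (fun n => by positivity) (fun n => ?_)
    (tendsto_one_div_add_atTop_nhds_zero_nat (𝕜 := ℝ))
  have h1 : (0 : ℝ) < (2 * n).factorial := by positivity
  have h2 : ((2 * n.succ).factorial : ℝ) = (2 * n + 2) * ((2 * n + 1) * (2 * n).factorial) := by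
    rw [show 2 * n.succ = (2 * n + 1) + 1 by omega, Nat.factorial_succ, Nat.factorial_succ]
    push_cast
    ring
  have hn : (0 : ℝ) ≤ n := n.cast_nonneg
  rw [coshSqrtCoeff, coshSqrtCoeff, h2, Real.norm_of_nonneg (by positivity),
    Real.norm_of_nonneg (by positivity), div_inv_eq_mul, inv_mul_eq_div,
    div_le_div_iff₀ (by positivity) (by positivity)]
  nlinarith [mul_nonneg hn h1.le, mul_nonneg hn (mul_nonneg hn h1.le)]

theorem analyticAt_coshSqrt (z : ℝ) : AnalyticAt ℝ coshSqrt z := by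
  have h := (FormalMultilinearSeries.ofScalars ℝ coshSqrtCoeff).hasFPowerSeriesOnBall
    (by rw [radius_coshSqrtCoeff]; exact ENNReal.zero_lt_top)
  exact h.analyticAt_of_mem (by rw [radius_coshSqrtCoeff]; simp)

/-- The entire function with `s² ↦ x₃(s)`. -/
def x3SqTP (z : ℝ) : ℝ := coshSqrt z - z * deriv coshSqrt z

theorem analyticAt_x3SqTP (z : ℝ) : AnalyticAt ℝ x3SqTP z :=
  (analyticAt_coshSqrt z).sub (analyticAt_id.mul (analyticAt_coshSqrt z).deriv)

/-- Differentiating `coshSqrt (s²) = cosh s` gives `2 s coshSqrt' (s²) = sinh s`, hence `(s / 2)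
sinh s = s² coshSqrt' (s²)`. -/
theorem x3SqTP_sq (s : ℝ) : x3SqTP (s ^ 2) = x3TP s := by
  have h1 : HasDerivAt (fun t : ℝ => coshSqrt (t ^ 2)) (deriv coshSqrt (s ^ 2) * (2 * s)) s := by
    have := (analyticAt_coshSqrt (s ^ 2)).differentiableAt.hasDerivAt.comp s (hasDerivAt_pow 2 s)
    convert! this using 1
    simp
  have h2 : deriv coshSqrt (s ^ 2) * (2 * s) = Real.sinh s := by
    refine h1.unique ((Real.hasDerivAt_cosh s).congr_of_eventuallyEq ?_)
    exact Filter.Eventually.of_forall coshSqrt_sq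
  rw [x3SqTP, x3TP, coshSqrt_sq, ← h2]
  ring

/-- The image of `f_TP` is the zero set in `S³₁` of an entire function. -/
theorem mem_range_fTP_iff (x : deSitter) :
    x ∈ range fTP ↔ x.1 3 = x3SqTP (4 * (x.1 1 ^ 2 + x.1 2 ^ 2)) := by
  rw [← range_fTildeTP]
  constructor
  · rintro ⟨p, rfl⟩
    have hp : p.1 0 ^ 2 + p.1 1 ^ 2 = p.1 2 ^ 2 / 4 := p.2
    change x3TP (p.1 2) = x3SqTP (4 * (p.1 0 ^ 2 + p.1 1 ^ 2))
    rw [hp, ← x3SqTP_sq]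
    congr 1
    ring
  · intro hx
    have hdS : -(x.1 0 * x.1 0) + x.1 1 * x.1 1 + x.1 2 * x.1 2 + x.1 3 * x.1 3 = 1 := x.2
    set r := 2 * √(x.1 1 ^ 2 + x.1 2 ^ 2)
    have hr : r ^ 2 = 4 * (x.1 1 ^ 2 + x.1 2 ^ 2) := by
      rw [mul_pow, Real.sq_sqrt (by positivity)]
      norm_num
    rw [← hr, x3SqTP_sq] at hx
    have h0 : x.1 0 ^ 2 = x0TP r ^ 2 := by
      have : x0TP r ^ 2 = r ^ 2 / 4 - 1 + x3TP r ^ 2 := by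
        rw [x0TP, x3TP]
        linear_combination (r ^ 2 / 4 - 1) * Real.cosh_sq r
      rw [this, ← hx, hr]
      linear_combination -hdS
    -- The sign of `x₀` decides between the parameters `r` and `-r`, as `x₀` is odd and `x₃` even.
    rcases sq_eq_sq_iff_eq_or_eq_neg.mp h0 with h | h
    · refine ⟨⟨![x.1 1, x.1 2, r], ?_⟩, Subtype.ext ?_⟩
      · change x.1 1 ^ 2 + x.1 2 ^ 2 = r ^ 2 / 4
        rw [hr]; ring
      · ext i
        fin_cases i
        · exact h.symm
        · rfl
        · rfl
        · exact hx.symm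
    · refine ⟨⟨![x.1 1, x.1 2, -r], ?_⟩, Subtype.ext ?_⟩
      · change x.1 1 ^ 2 + x.1 2 ^ 2 = (-r) ^ 2 / 4
        rw [neg_sq, hr]; ring
      · ext i
        fin_cases i
        · refine Eq.trans ?_ h.symm
          simp [fTildeTP, x0TP]
          ring
        · rfl
        · rfl
        · refine Eq.trans ?_ hx.symm
          simp [fTildeTP, x3TP]
          ring

/-- A real analytic function on `[0, 1]` that vanishes on `[0, ε)` vanishes identically. -/
theorem eqOn_zero_of_analyticOn_Icc {h : ℝ → ℝ} (hh : AnalyticOn ℝ h (Icc 0 1)) {ε : ℝ}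
    (hε : ε ∈ Ioo (0 : ℝ) 1) (h0 : ∀ t ∈ Ico (0 : ℝ) ε, h t = 0) : EqOn h 0 (Icc 0 1) := by
  -- At the endpoints analyticity is only one-sided, so the identity theorem is used on the open
  -- interval and continuity reaches `0` and `1`.
  have hI : AnalyticOnNhd ℝ h (Ioo 0 1) :=
    isOpen_Ioo.analyticOn_iff_analyticOnNhd.mp (hh.mono Ioo_subset_Icc_self)
  have hz : EqOn h 0 (Ioo 0 1) := by
    refine hI.eqOn_zero_of_preconnected_of_eventuallyEq_zero isPreconnected_Ioo
      (z₀ := ε / 2) ⟨by linarith [hε.1], by linarith [hε.1, hε.2]⟩ ?_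
    filter_upwards [Ioo_mem_nhds (show 0 < ε / 2 by linarith [hε.1])
      (show ε / 2 < ε by linarith [hε.1])] with t ht using h0 t ⟨ht.1.le, ht.2⟩
  have hcl : closure (Ioo (0 : ℝ) 1) = Icc 0 1 := closure_Ioo zero_ne_one
  exact hz.of_subset_closure hh.continuousOn continuousOn_const Ioo_subset_Icc_self hcl.ge

theorem analyticallyComplete_range_fTP : AnalyticallyComplete (Set.range fTP) := by
  refine ⟨range_nonempty _, fun Γ hΓ ⟨ε, hε, hS⟩ t ht => ?_⟩
  have hc : ∀ i, AnalyticOn ℝ (fun t => (Γ t : Fin 4 → ℝ) i) (Icc 0 1) := fun i x hx =>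
    analyticWithinAt_pi_iff.mp (hΓ x hx) i
  set h : ℝ → ℝ := fun t => (Γ t : Fin 4 → ℝ) 3 -
    x3SqTP (4 * ((Γ t : Fin 4 → ℝ) 1 ^ 2 + (Γ t : Fin 4 → ℝ) 2 ^ 2)) with hdef
  have hh : AnalyticOn ℝ h (Icc 0 1) := by
    refine (hc 3).sub fun x hx => ?_
    exact (analyticAt_x3SqTP _).comp_analyticWithinAt
      (analyticWithinAt_const.mul (((hc 1 x hx).pow 2).add ((hc 2 x hx).pow 2)))
  have := eqOn_zero_of_analyticOn_Icc hh hε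
    (fun t ht => sub_eq_zero.mpr ((mem_range_fTP_iff _).mp (hS t ht))) ht
  exact (mem_range_fTP_iff _).mpr (sub_eq_zero.mp this)

end

theorem mainTheorem6 :
    IsDCManifold 2 surfaceTP ∧
    (∀ p : surfaceTP, IsDCPoint 2 p ↔ (p : Fin 3 → ℝ) = 0) ∧
    (∀ q : ℝ × Real.Angle, fTP q = fTildeTP (toSurfaceTP q)) ∧
    Set.range fTildeTP = Set.range fTP ∧
    IsProperMap fTildeTP ∧
    IsSpacelikeCMCOneDCImmersion fTildeTP ∧
    AnalyticallyComplete (Set.range fTP) :=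
  ⟨isDCManifold_surfaceTP, isDCPoint_surfaceTP_iff, fTP_eq, range_fTildeTP, isProperMap_fTildeTP,
    isSpacelikeCMCOneDCImmersion_fTildeTP, analyticallyComplete_range_fTP⟩
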